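/- Let $X_1,X_2,\dots$ be independent and identically distributed random elements with common law $F$, let $\Theta\subseteq\mathbb R^q$, and let $g(x;\theta)\in\mathbb R^m$ be an estimating function. For $\theta\in\Theta$ define the profile empirical likelihood ratio $$W_n(\theta)=\inf\Big\{-\sum_{i=1}^n\log(np_i)\;:\;p_i>0,\ \sum_{i=1}^np_i=1,\ \sum_{i=1}^np_i\,g(X_i;\theta)=0\Big\},\qquad \inf\emptyset=+\infty .$$ A maximum empirical likelihood estimator (MELE) $\hat\theta_n$ is a global minimizer of $W_n$ over $\Theta$. Assume: (C1) $\mathbb E\,g(X;\theta)=0$ has a unique solution $\theta^*$ in $\Theta$. (C2) For every $\theta\in\Theta$, the matrix $\mathbb E[g(X;\theta)g(X;\theta)^\top]$ is finite and positive definite, and $\mathbb E\|g(X;\theta)\|^3<\infty$. (C3) For every compact $C\subseteq\Theta$ there is a function $G$ with $\mathbb E\,G(X)^2<\infty$ such that $\|g(X;\theta')-g(X;\theta)\|\le G(X)\|\theta'-\theta\|$ for all $\theta,\theta'\in C$, almost surely. (C4) $\Theta$ is a closed subset of $\mathbb R^q$. (C5) There are $k\ge 0$ and a continuous scaling $b:\Theta\to\mathbb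 R^{m\times k}$ (for instance a vector, $k=1$, or a scalar function times the identity, $k=m$) such that $h(x;\theta)=b(\theta)^\top g(x;\theta)$ satisfies, with $\theta,\theta'$ ranging over $\Theta$, (i) $\mathbb E\big\{\sup_{\|\theta\|\ge r}\|h(X;\theta)\|^2\big\}<\infty$ for some $r$; (ii) $\liminf_{\|\theta\|\to\infty}\|\mathbb E\,h(X;\theta)\|>0$; (iii) $\mathbb E\big[\lim_{r\to\infty}\Delta_h(X;r)\big]=0$, where $\Delta_h(X;r)=\sup_{\|\theta\|,\|\theta'\|\ge r}\|h(X;\theta)-h(X;\theta')\|$. (If $\Theta$ is bounded, (C5) holds trivially.) Then $\hat\theta_n\to\theta^*$ almost surely as $n\to\infty$. More precisely, almost surely, every sequence $(\hat\theta_n)$ such that $\hat\theta_n$ is a global minimizer of $W_n$ over $\Theta$ for all sufficiently large $n$ converges to $\theta^*$. Uniqueness of the minimizer is not assumed. -/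

import Mathlib

open MeasureTheory ProbabilityTheory Filter Topology Bornology
open scoped ENNReal

namespace EmpiricalLikelihood

variable {S : Type*}

/-- The admissible weights for the data `x₁, …, xₙ` at the parameter value `θ`:
positive weights with sum one under which the estimating function has mean zero.
Vanishing weights are left out because they make the log empirical likelihood `-∞`. -/
def weights {q m n : ℕ} (g : S → EuclideanSpace ℝ (Fin q) → EuclideanSpace ℝ (Fin m))
    (x : Fin n → S) (θ : EuclideanSpace ℝ (Fin q)) : Set (Fin n → ℝ) :=
  {p | (∀ i, 0 < p i) ∧ ∑ i, p i = 1 ∧ ∑ i, p i • g (x i) θ = 0}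

/-- The profile log empirical likelihood: the supremum of `∑ log pᵢ` over the admissible
weights, equal to `-∞` when there are none. -/
noncomputable def profileLogEL {q m n : ℕ}
    (g : S → EuclideanSpace ℝ (Fin q) → EuclideanSpace ℝ (Fin m))
    (x : Fin n → S) (θ : EuclideanSpace ℝ (Fin q)) : EReal :=
  ⨆ p ∈ weights g x θ, ((∑ i, Real.log (p i) : ℝ) : EReal)

/-- The profile empirical likelihood ratio function `Wₙ(θ) = - ∑ log (n p̂ᵢ)`, where `p̂` are the
maximizing weights; it is `+∞` when there are no admissible weights. -/
noncomputable def W {q m n : ℕ}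
    (g : S → EuclideanSpace ℝ (Fin q) → EuclideanSpace ℝ (Fin m))
    (x : Fin n → S) (θ : EuclideanSpace ℝ (Fin q)) : EReal :=
  - profileLogEL g x θ - ((n * Real.log n : ℝ) : EReal)

/-- `θhat` is a maximum empirical likelihood estimate for the data `x₁, …, xₙ`: a global minimizer
of `Wₙ` over the parameter space `Θ`. -/
def IsMELE {q m n : ℕ} (g : S → EuclideanSpace ℝ (Fin q) → EuclideanSpace ℝ (Fin m))
    (Θ : Set (EuclideanSpace ℝ (Fin q))) (x : Fin n → S)
    (θhat : EuclideanSpace ℝ (Fin q)) : Prop :=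
  θhat ∈ Θ ∧ ∀ θ ∈ Θ, W g x θhat ≤ W g x θ

variable [MeasurableSpace S]

/-- (C1) `E g(X; θ) = 0` has the unique solution `θstar` in `Θ`. -/
def C1 {q m : ℕ} (F : Measure S)
    (g : S → EuclideanSpace ℝ (Fin q) → EuclideanSpace ℝ (Fin m))
    (Θ : Set (EuclideanSpace ℝ (Fin q))) (θstar : EuclideanSpace ℝ (Fin q)) : Prop :=
  θstar ∈ Θ ∧ ∀ θ ∈ Θ, (∫ x, g x θ ∂F = 0 ↔ θ = θstar)

/-- (C2) For every `θ` in `Θ`, `g(X; θ)` is a random vector with `E ‖g(X; θ)‖³ < ∞` (so that its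
second moments are finite) whose matrix of second moments `E g(X; θ) g(X; θ)ᵀ` is positive
definite. -/
def C2 {q m : ℕ} (F : Measure S)
    (g : S → EuclideanSpace ℝ (Fin q) → EuclideanSpace ℝ (Fin m))
    (Θ : Set (EuclideanSpace ℝ (Fin q))) : Prop :=
  ∀ θ ∈ Θ, MemLp (fun x => g x θ) 3 F ∧
    (Matrix.of fun i j : Fin m => ∫ x, g x θ i * g x θ j ∂F).PosDef

/-- (C3) On every compact subset of `Θ`, `g(x; ·)` is Lipschitz with a square-integrable
Lipschitz constant `G(x)`. -/
def C3 {q m : ℕ} (F : Measure S)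
    (g : S → EuclideanSpace ℝ (Fin q) → EuclideanSpace ℝ (Fin m))
    (Θ : Set (EuclideanSpace ℝ (Fin q))) : Prop :=
  ∀ C ⊆ Θ, IsCompact C → ∃ G : S → ℝ, MemLp G 2 F ∧
    ∀ᵐ x ∂F, ∀ θ ∈ C, ∀ θ' ∈ C, ‖g x θ' - g x θ‖ ≤ G x * ‖θ' - θ‖

/-- The oscillation `Δ_h(x; r)` of `h(x; ·)` over the `θ` in `Θ` with `‖θ‖ ≥ r`. -/
noncomputable def oscAtInfty {q k : ℕ}
    (h : S → EuclideanSpace ℝ (Fin q) → EuclideanSpace ℝ (Fin k))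
    (Θ : Set (EuclideanSpace ℝ (Fin q))) (x : S) (r : ℝ) : ℝ≥0∞ :=
  ⨆ θ ∈ {θ ∈ Θ | r ≤ ‖θ‖}, ⨆ θ' ∈ {θ ∈ Θ | r ≤ ‖θ‖}, ‖h x θ - h x θ'‖ₑ

/-- (C5) There is a continuous scaling `b` on `Θ` such that `h(x; θ) = b(θ)ᵀ g(x; θ)` is
non-degenerate at infinity. Here `b θ` is the linear map `v ↦ b(θ)ᵀ v` into `ℝᵏ`: for `k = 1` the
scaling is by a vector and `h` is real-valued, and for `k = m` the scaling may be by a scalar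
function (a multiple of the identity), `h` being vector-valued. In (iii) the infimum over `r` is the
limit as `r → ∞`, because `Δ_h` is nonincreasing in `r`. -/
def C5 {q m : ℕ} (F : Measure S)
    (g : S → EuclideanSpace ℝ (Fin q) → EuclideanSpace ℝ (Fin m))
    (Θ : Set (EuclideanSpace ℝ (Fin q))) : Prop :=
  ∃ (k : ℕ) (b : EuclideanSpace ℝ (Fin q) →
      (EuclideanSpace ℝ (Fin m) →L[ℝ] EuclideanSpace ℝ (Fin k)))
    (h : S → EuclideanSpace ℝ (Fin q) → EuclideanSpace ℝ (Fin k)),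
    ContinuousOn b Θ ∧ (∀ x θ, h x θ = b θ (g x θ)) ∧
    -- (i) the second moment of the supremum near infinity is finite
    (∃ r : ℝ, ∫⁻ x, ⨆ θ ∈ {θ ∈ Θ | r ≤ ‖θ‖}, ‖h x θ‖ₑ ^ 2 ∂F < ∞) ∧
    -- (ii) the mean stays away from zero
    0 < liminf (fun θ => ‖∫ x, h x θ ∂F‖ₑ) (cobounded (EuclideanSpace ℝ (Fin q)) ⊓ 𝓟 Θ) ∧
    -- (iii) the oscillation vanishes at infinity
    ∫⁻ x, ⨅ r : ℝ, oscAtInfty h Θ x r ∂F = 0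

end EmpiricalLikelihood

/-!
Strong consistency of the maximum empirical likelihood estimator rests on two orders of magnitude:
almost surely `Wₙ(θstar) = o(√n)`, while `Wₙ` is at least of order `√n` uniformly over the
parameters that keep a positive distance from `θstar`. A global minimizer is therefore eventually
as close to `θstar` as desired.

*Lower bound.* By weak duality (`sum_log_one_add_le_W`), `Wₙ(θ)` is at least `∑ log (1 + L gᵢ)` for
every linear functional `L` with all `L gᵢ > -1`. Taking `L` of size `n ^ (-1/2)` keeps all the
values `L gᵢ` small once their squares have a bounded average, and then the sum is about `√n` times
the sample mean of the unscaled functional (`sqrt_le_W`). Hence `Wₙ` is of order `√n` on every set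
of parameters over which suitable functionals have a lower envelope with positive mean and
integrable squares (`isLargeOn_of_envelope`); only the pointwise strong law is needed. Near a
parameter `θ₀ ≠ θstar` the envelope comes from the Lipschitz condition, and compactness makes
this uniform over bounded sets. Near infinity it comes from `h(·; θ₀)` minus the oscillation of
`h`, for one far-away `θ₀` (`C5.exists_isLargeOn`); a linear scaling of `g` is harmless since any
functional of `h` is a functional of `g`. The suprema over parameters are measurable up to null
sets because `g(x; ·)` is almost surely continuous.

*Upper bound.* At `θstar` an explicit admissible weight vector, affine in the observations, shows
that `Wₙ` is at most a constant times `n ‖vbar‖²` for the sample mean `vbar`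
(`W_le_mul_norm_sq`). Positivity of these weights requires `‖vbar‖ maxᵢ ‖gᵢ‖ → 0`; the third moment
gives `maxᵢ ‖gᵢ‖ = O(n ^ (1/3))`, so the rate `vbar = o(n ^ (-1/3))` is wanted. It follows from
`L²`-bounded martingale convergence of `∑ gᵢ / i ^ (2/3)` and Kronecker's lemma
(`ae_tendsto_mul_average_pow_three`).
-/

namespace EmpiricalLikelihood

/-! ### Almost sure convergence of sums and averages -/

section

/-- **Kronecker's lemma**. -/
theorem tendsto_sum_div_of_tendsto_sum_div {a y : ℕ → ℝ} (hpos : ∀ n, 0 < a n)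
    (hmono : Monotone a) (ha : Tendsto a atTop atTop) {s : ℝ}
    (hs : Tendsto (fun n => ∑ i ∈ Finset.range n, y i / a i) atTop (𝓝 s)) :
    Tendsto (fun n => (∑ i ∈ Finset.range n, y i) / a n) atTop (𝓝 0) := by
  set u : ℕ → ℝ := fun n => ∑ i ∈ Finset.range n, y i / a i with hu
  -- summation by parts
  have parts : ∀ n, ∑ i ∈ Finset.range n, y i
      = a n * (u n - s) - ∑ i ∈ Finset.range n, (u (i + 1) - s) * (a (i + 1) - a i)
        + a 0 * s := by
    intro n
    induction n with
    | zero => simp [hu]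
    | succ n ih =>
      have h : u (n + 1) = u n + y n / a n := by simp [hu, Finset.sum_range_succ]
      have h' : a n * (y n / a n) = y n := by
        have := (hpos n).ne'
        field_simp
      rw [Finset.sum_range_succ, Finset.sum_range_succ, ih, h]
      linear_combination -h'
  have hdiv : Tendsto (fun n => (a n)⁻¹) atTop (𝓝 0) := tendsto_inv_atTop_zero.comp ha
  have hlim : Tendsto (fun n => u (n + 1) - s) atTop (𝓝 0) := by
    have := ((tendsto_add_atTop_iff_nat 1).2 hs).sub_const s
    simpa using this
  have hsum : ∀ n, ∑ i ∈ Finset.range n, (a (i + 1) - a i) = a n - a 0 :=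
    fun n => Finset.sum_range_sub a n
  have hO : (fun n => ∑ i ∈ Finset.range n, (u (i + 1) - s) * (a (i + 1) - a i))
      =o[atTop] fun n => ∑ i ∈ Finset.range n, (a (i + 1) - a i) := by
    refine Asymptotics.IsLittleO.sum_range ?_ (fun i => sub_nonneg.2 (hmono i.le_succ)) ?_
    · have h1 : (fun n => u (n + 1) - s) =o[atTop] fun _ => (1 : ℝ) :=
        (Asymptotics.isLittleO_one_iff ℝ).2 hlim
      simpa using h1.mul_isBigO (Asymptotics.isBigO_refl (fun n => a (n + 1) - a n) atTop)
    · simp only [hsum]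
      exact tendsto_atTop_add_const_right _ _ ha
  have hO' : (fun n => ∑ i ∈ Finset.range n, (u (i + 1) - s) * (a (i + 1) - a i))
      =o[atTop] a := by
    refine hO.trans_isBigO (Asymptotics.IsBigO.of_bound 1 (Eventually.of_forall fun n => ?_))
    rw [hsum, Real.norm_of_nonneg (sub_nonneg.2 (hmono n.zero_le)),
      Real.norm_of_nonneg (hpos n).le]
    linarith [hpos 0]
  have h1 := hO'.tendsto_div_nhds_zero
  have h2 : Tendsto (fun n => u n - s) atTop (𝓝 0) := by simpa using hs.sub_const s
  have h3 := (h2.sub h1).add (hdiv.const_mul (a 0 * s))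
  simp only [sub_zero, mul_zero, add_zero] at h3
  refine h3.congr fun n => ?_
  rw [parts n]
  have := (hpos n).ne'
  field_simp

variable {Ω S : Type*} [MeasurableSpace Ω] [MeasurableSpace S] {μ : Measure Ω}

/-- Convergence of a random series: independent centred summands with bounded partial sums of
variances. The partial sums form a martingale bounded in `L²`. -/
theorem ae_exists_tendsto_sum_of_iIndepFun [IsProbabilityMeasure μ] {Z : ℕ → Ω → ℝ}
    (hL2 : ∀ i, MemLp (Z i) 2 μ) (hindep : iIndepFun Z μ) (hmean : ∀ i, ∫ ω, Z i ω ∂μ = 0)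
    {R : ℝ} (hvar : ∀ n, ∑ i ∈ Finset.range n, ∫ ω, Z i ω ^ 2 ∂μ ≤ R) :
    ∀ᵐ ω ∂μ, ∃ s, Tendsto (fun n => ∑ i ∈ Finset.range n, Z i ω) atTop (𝓝 s) := by
  -- pass to strongly measurable versions, for which the natural filtration is defined
  wlog hmeas : ∀ i, StronglyMeasurable (Z i) generalizing Z
  · have hae : ∀ i, Z i =ᵐ[μ] (hL2 i).1.mk (Z i) := fun i => (hL2 i).1.ae_eq_mk
    have key := this (Z := fun i => (hL2 i).1.mk (Z i)) (fun i => (hL2 i).ae_eq (hae i))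
      (hindep.congr hae) (fun i => by rw [← hmean i]; exact integral_congr_ae (hae i).symm)
      (fun n => by
        refine le_trans (le_of_eq (Finset.sum_congr rfl fun i _ => integral_congr_ae ?_)) (hvar n)
        filter_upwards [hae i] with ω h
        rw [h])
      (fun i => (hL2 i).1.stronglyMeasurable_mk)
    filter_upwards [key, ae_all_iff.2 hae] with ω ⟨s, h⟩ h'
    exact ⟨s, h.congr fun n => Finset.sum_congr rfl fun i _ => (h' i).symm⟩
  have hint : ∀ i, Integrable (Z i) μ := fun i => (hL2 i).integrable (by norm_num)
  set 𝓕 := Filtration.natural Z hmeas with h𝓕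
  set M : ℕ → Ω → ℝ := fun n ω => ∑ i ∈ Finset.range (n + 1), Z i ω with hM
  have hMint : ∀ n, Integrable (M n) μ := fun n => integrable_finsetSum _ fun i _ => hint i
  have hadp : StronglyAdapted 𝓕 M := fun n =>
    Finset.stronglyMeasurable_fun_sum _ fun i hi =>
      (Filtration.stronglyAdapted_natural hmeas i).mono
        (𝓕.mono (Nat.lt_succ_iff.1 (Finset.mem_range.1 hi)))
  have hmart : Martingale M 𝓕 μ := by
    refine martingale_nat hadp hMint fun n => ?_
    have hsucc : M (n + 1) = M n + Z (n + 1) := by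
      ext ω
      simp [hM, Finset.sum_range_succ _ (n + 1)]
    have h1 : μ[M n | 𝓕 n] = M n :=
      condExp_of_stronglyMeasurable (𝓕.le n) (hadp n) (hMint n)
    have h2 : μ[Z (n + 1) | 𝓕 n] =ᵐ[μ] fun _ => μ[Z (n + 1)] :=
      condExp_indep_eq (hmeas (n + 1)).measurable.comap_le (𝓕.le n)
        (comap_measurable (Z (n + 1))).stronglyMeasurable
        (hindep.indep_comap_natural_of_lt hmeas n.lt_succ_self)
    rw [hsucc]
    filter_upwards [condExp_add (hMint n) (hint (n + 1)) (𝓕 n), h2] with ω h3 h4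
    rw [h3, Pi.add_apply, h1, h4, hmean, add_zero]
  have hsq : ∀ n, ∫ ω, M n ω ^ 2 ∂μ ≤ R := by
    intro n
    have hMeq : M n = ∑ i ∈ Finset.range (n + 1), Z i := by ext ω; simp [hM]
    have hL : MemLp (M n) 2 μ := hMeq ▸ memLp_finsetSum' _ fun i _ => hL2 i
    have h0 : ∫ ω, M n ω ∂μ = 0 := by
      simp only [hM]
      rw [integral_finsetSum _ fun i _ => hint i]
      simp [hmean]
    have hv : Var[M n; μ] = ∑ i ∈ Finset.range (n + 1), Var[Z i; μ] := by
      rw [hMeq]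
      exact IndepFun.variance_sum (fun i _ => hL2 i)
        (fun i _ j _ hij => hindep.indepFun hij)
    rw [← variance_of_integral_eq_zero hL.1.aemeasurable h0, hv]
    refine le_trans (le_of_eq (Finset.sum_congr rfl fun i _ => ?_)) (hvar (n + 1))
    exact variance_of_integral_eq_zero (hL2 i).1.aemeasurable (hmean i)
  have hbdd : ∀ n, eLpNorm (M n) 1 μ ≤ ((1 + R).toNNReal : ℝ≥0∞) := by
    intro n
    have hMeq : M n = ∑ i ∈ Finset.range (n + 1), Z i := by ext ω; simp [hM]
    have hL : MemLp (M n) 2 μ := hMeq ▸ memLp_finsetSum' _ fun i _ => hL2 i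
    rw [eLpNorm_one_eq_lintegral_enorm, ← ofReal_integral_norm_eq_lintegral_enorm (hMint n)]
    refine ENNReal.ofReal_le_ofReal ?_
    calc ∫ ω, ‖M n ω‖ ∂μ ≤ ∫ ω, (1 + M n ω ^ 2) ∂μ := by
          refine integral_mono (hMint n).norm ((integrable_const 1).add hL.integrable_sq)
            fun ω => ?_
          simp only [Real.norm_eq_abs, ← sq_abs (M n ω)]
          nlinarith [sq_nonneg (|M n ω| - 1), sq_nonneg (|M n ω|)]
      _ = 1 + ∫ ω, M n ω ^ 2 ∂μ := by
          rw [integral_add (integrable_const 1) hL.integrable_sq]; simp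
      _ ≤ 1 + R := by linarith [hsq n]
  filter_upwards [hmart.submartingale.exists_ae_tendsto_of_bdd hbdd] with ω ⟨s, h⟩
  exact ⟨s, (tendsto_add_atTop_iff_nat 1).1 h⟩

/-- The strong law of large numbers for a function of the observations. -/
theorem ae_tendsto_average {F : Measure S} {X : ℕ → Ω → S}
    (hlaw : ∀ i, HasLaw (X i) F μ) (hindep : iIndepFun X μ) {φ : S → ℝ} (hφ : Integrable φ F) :
    ∀ᵐ ω ∂μ, Tendsto (fun n : ℕ => (∑ i ∈ Finset.range n, φ (X i ω)) / n) atTop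
      (𝓝 (∫ x, φ x ∂F)) := by
  have hm : ∀ i, AEMeasurable φ (μ.map (X i)) := fun i => by
    rw [(hlaw i).map_eq]; exact hφ.1.aemeasurable
  have h0 : ∫ ω, (φ ∘ X 0) ω ∂μ = ∫ x, φ x ∂F := by
    rw [← (hlaw 0).map_eq]
    exact (integral_map (hlaw 0).aemeasurable (hm 0).aestronglyMeasurable).symm
  have hint : Integrable (φ ∘ X 0) μ := by
    have h := hφ
    rw [← (hlaw 0).map_eq] at h
    exact h.comp_aemeasurable (hlaw 0).aemeasurable
  have key := strong_law_ae_real (μ := μ) (fun i => φ ∘ X i) hint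
    (fun i j hij => (hindep.comp₀ (fun _ => φ) (fun i => (hlaw i).aemeasurable) hm).indepFun hij)
    (fun i => IdentDistrib.comp_of_aemeasurable
      ⟨(hlaw i).aemeasurable, (hlaw 0).aemeasurable, by rw [(hlaw i).map_eq, (hlaw 0).map_eq]⟩
      (hm i))
  rw [h0] at key
  exact key

/-- Rate in the strong law: a centred, square-integrable function of the observations has
averages `o(n ^ (-1/3))`, written without roots. -/
theorem ae_tendsto_mul_average_pow_three [IsProbabilityMeasure μ] {F : Measure S} {X : ℕ → Ω → S}
    (hlaw : ∀ i, HasLaw (X i) F μ) (hindep : iIndepFun X μ) {φ : S → ℝ} (hφ : MemLp φ 2 F)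
    (hmean : ∫ x, φ x ∂F = 0) :
    ∀ᵐ ω ∂μ, Tendsto (fun n : ℕ => (n : ℝ) * |(∑ i ∈ Finset.range n, φ (X i ω)) / n| ^ 3)
      atTop (𝓝 0) := by
  set a : ℕ → ℝ := fun n => ((n : ℝ) + 1) ^ (2 / 3 : ℝ) with ha
  have hbase : ∀ n : ℕ, (0 : ℝ) < (n : ℝ) + 1 := fun n => by positivity
  have hpos : ∀ n, 0 < a n := fun n => Real.rpow_pos_of_pos (hbase n) _
  have hmono : Monotone a := fun i j hij =>
    Real.rpow_le_rpow (hbase i).le (by simpa using hij) (by norm_num)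
  have htop : Tendsto a atTop atTop :=
    (tendsto_rpow_atTop (by norm_num : (0 : ℝ) < 2 / 3)).comp
      (tendsto_atTop_add_const_right _ _ tendsto_natCast_atTop_atTop)
  have hsummable : Summable fun n => (a n ^ 2)⁻¹ := by
    have h := (summable_nat_add_iff 1).2
      (Real.summable_nat_rpow_inv.2 (by norm_num : (1 : ℝ) < 4 / 3))
    refine h.congr fun n => ?_
    simp only [ha]
    rw [← Real.rpow_natCast, ← Real.rpow_mul (hbase n).le]
    norm_num
  have hmp : ∀ i, MemLp (φ ∘ X i) 2 μ := fun i => by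
    have h := hφ
    rw [← (hlaw i).map_eq] at h
    exact h.comp_of_map (hlaw i).aemeasurable
  have hmom : ∀ (ψ : S → ℝ), AEStronglyMeasurable ψ F → ∀ i,
      ∫ ω, ψ (X i ω) ∂μ = ∫ x, ψ x ∂F := fun ψ hψ i => by
    rw [← (hlaw i).map_eq] at hψ ⊢
    exact (integral_map (hlaw i).aemeasurable hψ).symm
  have hindep' : iIndepFun (fun i ω => φ (X i ω) / a i) μ := by
    refine hindep.comp₀ (fun i x => φ x / a i) (fun i => (hlaw i).aemeasurable) fun i => ?_
    rw [(hlaw i).map_eq]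
    exact hφ.1.aemeasurable.div_const _
  have hconv := ae_exists_tendsto_sum_of_iIndepFun (Z := fun i ω => φ (X i ω) / a i)
    (fun i => by simpa [div_eq_inv_mul] using (hmp i).const_mul (a i)⁻¹) hindep'
    (fun i => by rw [integral_div, hmom φ hφ.1 i, hmean, zero_div])
    (R := (∫ x, φ x ^ 2 ∂F) * ∑' n, (a n ^ 2)⁻¹) (fun n => by
      have h : ∀ i, ∫ ω, (φ (X i ω) / a i) ^ 2 ∂μ = (∫ x, φ x ^ 2 ∂F) * (a i ^ 2)⁻¹ := fun i => by
        simp only [div_pow, integral_div, hmom (fun x => φ x ^ 2) (hφ.1.pow 2) i]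
        rw [div_eq_mul_inv]
      simp only [h, ← Finset.mul_sum]
      exact mul_le_mul_of_nonneg_left
        (hsummable.sum_le_tsum _ fun i _ => by positivity)
        (integral_nonneg fun x => sq_nonneg _))
  filter_upwards [hconv] with ω ⟨s, hs⟩
  have hk := (tendsto_sum_div_of_tendsto_sum_div hpos hmono htop hs).abs.pow 3
  simp only [abs_zero, ne_eq, OfNat.ofNat_ne_zero, not_false_eq_true, zero_pow] at hk
  -- `(n + 1) ^ 2 ≤ 4 * n ^ 2` replaces the weight `(n + 1) ^ (2 / 3)` by `n ^ (2 / 3)`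
  have hk4 := hk.const_mul 4
  rw [mul_zero] at hk4
  refine squeeze_zero' (Eventually.of_forall fun n => by positivity) ?_ hk4
  filter_upwards [eventually_ge_atTop 1] with n hn
  have hn' : (1 : ℝ) ≤ n := by exact_mod_cast hn
  have hcube : a n ^ 3 = ((n : ℝ) + 1) ^ 2 := by
    simp only [ha]
    rw [← Real.rpow_natCast, ← Real.rpow_mul (hbase n).le]
    norm_num
  rw [abs_div, abs_div, abs_of_pos (hpos n), abs_of_pos (by positivity : (0 : ℝ) < n), div_pow,
    div_pow, hcube]
  set T := |∑ i ∈ Finset.range n, φ (X i ω)| ^ 3 with hT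
  have hT0 : 0 ≤ T := by positivity
  have e1 : (n : ℝ) * (T / (n : ℝ) ^ 3) = T / (n : ℝ) ^ 2 := by
    field_simp
  rw [e1, ← mul_div_assoc, div_le_div_iff₀ (by positivity) (by positivity)]
  nlinarith [mul_nonneg hT0 (by nlinarith : (0 : ℝ) ≤ 4 * (n : ℝ) ^ 2 - ((n : ℝ) + 1) ^ 2)]

end

/-! ### Empirical likelihood of a fixed data set -/

section

variable {S : Type*} {q m n : ℕ}
  {g : S → EuclideanSpace ℝ (Fin q) → EuclideanSpace ℝ (Fin m)}
  {x : Fin n → S} {θ : EuclideanSpace ℝ (Fin q)}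

theorem sub_two_mul_sq_le_log_one_add {y : ℝ} (hy : |y| ≤ 1 / 2) :
    y - 2 * y ^ 2 ≤ Real.log (1 + y) := by
  obtain ⟨h1, h2⟩ := abs_le.1 hy
  have hpos : 0 < 1 + y := by linarith
  refine le_trans ?_ (Real.one_sub_inv_le_log_of_pos hpos)
  rw [inv_eq_one_div, le_sub_iff_add_le, ← le_sub_iff_add_le', div_le_iff₀ hpos]
  nlinarith [mul_nonneg (sq_nonneg y) (by linarith : 0 ≤ 1 + 2 * y)]

/-- Weak duality for the empirical likelihood: every linear functional `L` of the estimating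
function that exceeds `-1` at the data bounds the likelihood ratio from below. -/
theorem sum_log_one_add_le_W (hn : 0 < n) (L : EuclideanSpace ℝ (Fin m) →L[ℝ] ℝ)
    (hL : ∀ i, 0 < 1 + L (g (x i) θ)) :
    ((∑ i, Real.log (1 + L (g (x i) θ)) : ℝ) : EReal) ≤ W g x θ := by
  have hn' : (0 : ℝ) < n := by exact_mod_cast hn
  have hprof : profileLogEL g x θ
      ≤ ((-(n * Real.log n) - ∑ i, Real.log (1 + L (g (x i) θ)) : ℝ) : EReal) := by
    refine iSup₂_le fun p ⟨hp, hsum, hzero⟩ => EReal.coe_le_coe_iff.2 ?_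
    -- the inequality `log z ≤ z - 1` at `z = n pᵢ (1 + L gᵢ)`, whose average over `i` is one
    have hlog : ∀ i, Real.log n + Real.log (p i) + Real.log (1 + L (g (x i) θ))
        ≤ n * (p i * (1 + L (g (x i) θ))) - 1 := fun i => by
      rw [← Real.log_mul hn'.ne' (hp i).ne',
        ← Real.log_mul (mul_pos hn' (hp i)).ne' (hL i).ne', ← mul_assoc]
      exact Real.log_le_sub_one_of_pos (mul_pos (mul_pos hn' (hp i)) (hL i))
    have hmean : ∑ i, p i * L (g (x i) θ) = 0 := by
      have h := congrArg L hzero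
      simpa [map_sum] using h
    have h := Finset.sum_le_sum fun i (_ : i ∈ Finset.univ) => hlog i
    simp only [Finset.sum_add_distrib, Finset.sum_sub_distrib, ← Finset.mul_sum, mul_add, mul_one,
      hsum, hmean] at h
    simp only [Finset.sum_const, Finset.card_univ, Fintype.card_fin, nsmul_eq_mul, mul_one] at h
    linarith
  calc ((∑ i, Real.log (1 + L (g (x i) θ)) : ℝ) : EReal)
      = -((-(n * Real.log n) - ∑ i, Real.log (1 + L (g (x i) θ)) : ℝ) : EReal)
        - ((n * Real.log n : ℝ) : EReal) := by
        rw [← EReal.coe_neg, ← EReal.coe_sub]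
        congr 1
        ring
    _ ≤ W g x θ := EReal.sub_le_sub (EReal.neg_le_neg_iff.2 hprof) le_rfl

theorem W_le_of_mem_weights {p : Fin n → ℝ} (hp : p ∈ weights g x θ) :
    W g x θ ≤ ((-∑ i, Real.log (p i) - n * Real.log n : ℝ) : EReal) := by
  rw [EReal.coe_sub, EReal.coe_neg]
  exact EReal.sub_le_sub
    (EReal.neg_le_neg_iff.2 (le_iSup₂ (f := fun p (_ : p ∈ weights g x θ) =>
      ((∑ i, Real.log (p i) : ℝ) : EReal)) p hp)) le_rfl

/-- If a functional of the estimating function has sample mean at least `a` and sample second moment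
at most `b`, then the likelihood ratio is at least of order `a √n / √b`. -/
theorem sqrt_le_W {a b : ℝ} (hn : 0 < n) (hb : 0 < b) (L : EuclideanSpace ℝ (Fin m) →L[ℝ] ℝ)
    (hmean : a * n ≤ ∑ i, L (g (x i) θ)) (hsq : ∑ i, L (g (x i) θ) ^ 2 ≤ b * n) :
    ((a / (2 * √b) * √n - 1 / 2 : ℝ) : EReal) ≤ W g x θ := by
  have hn' : (0 : ℝ) < n := by exact_mod_cast hn
  have hsn : 0 < √(n : ℝ) := Real.sqrt_pos.2 hn'
  have hsb : 0 < √b := Real.sqrt_pos.2 hb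
  -- the dual variable is `L / (2 √b √n)`; this scaling keeps all its values within `[-1/2, 1/2]`
  set r : ℝ := (2 * √b * √n)⁻¹ with hr
  have hr0 : 0 < r := by positivity
  have hr2 : r ^ 2 * (b * n) = 1 / 4 := by
    rw [hr, inv_pow, mul_pow, mul_pow, Real.sq_sqrt hb.le, Real.sq_sqrt hn'.le]
    field_simp
    norm_num
  have hsum2 : ∑ i, (r * L (g (x i) θ)) ^ 2 ≤ 1 / 4 := by
    simp only [mul_pow, ← Finset.mul_sum]
    rw [← hr2]
    exact mul_le_mul_of_nonneg_left hsq (sq_nonneg r)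
  have habs : ∀ i, |r * L (g (x i) θ)| ≤ 1 / 2 := fun i => by
    have h := (Finset.single_le_sum (f := fun i => (r * L (g (x i) θ)) ^ 2)
      (fun j _ => sq_nonneg _) (Finset.mem_univ i)).trans hsum2
    exact abs_le_of_sq_le_sq (by norm_num at h ⊢; linarith) (by norm_num)
  have hdual := sum_log_one_add_le_W (g := g) (x := x) (θ := θ) hn (r • L) (fun i => by
    have := (abs_le.1 (habs i)).1
    simp only [_root_.smul_apply, smul_eq_mul]
    linarith)
  refine le_trans (EReal.coe_le_coe_iff.2 ?_) hdual
  have h := Finset.sum_le_sum fun i (_ : i ∈ Finset.univ) =>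
    sub_two_mul_sq_le_log_one_add (habs i)
  simp only [Finset.sum_sub_distrib, ← Finset.mul_sum] at h
  simp only [_root_.smul_apply, smul_eq_mul]
  have hmain : a / (2 * √b) * √n ≤ r * ∑ i, L (g (x i) θ) := by
    refine le_trans (le_of_eq ?_) (mul_le_mul_of_nonneg_left hmean hr0.le)
    have hsqn : (n : ℝ) = √n * √n := (Real.mul_self_sqrt hn'.le).symm
    rw [hr]
    field_simp
    rw [Real.sq_sqrt hn'.le]
  linarith

/-- If the sample covariance of the estimating function is at least `c` and the sample mean is small
compared with the largest observation, then the likelihood ratio is at most `2 n / c` times the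
squared sample mean. The weights are `pᵢ = (1 - ⟪l, vᵢ - vbar⟫) / n`, where the sample covariance
maps `l` to the sample mean `vbar` of the `vᵢ = g (x i) θ`. -/
theorem W_le_mul_norm_sq {c : ℝ} {vbar : EuclideanSpace ℝ (Fin m)} (hn : 0 < n) (hc : 0 < c)
    (hvbar : ∑ i, g (x i) θ = (n : ℝ) • vbar)
    (hcov : ∀ l : EuclideanSpace ℝ (Fin m),
      c * ‖l‖ ^ 2 ≤ (∑ i, inner ℝ l (g (x i) θ) ^ 2) / n - inner ℝ l vbar ^ 2)
    (hsmall : ∀ i, ‖vbar‖ * (‖g (x i) θ‖ + ‖vbar‖) ≤ c / 2) :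
    W g x θ ≤ ((2 * (n * ‖vbar‖ ^ 2) / c : ℝ) : EReal) := by
  have hn' : (0 : ℝ) < n := by exact_mod_cast hn
  set v : Fin n → EuclideanSpace ℝ (Fin m) := fun i => g (x i) θ with hv
  have hinner : ∀ l, ∑ i, inner ℝ l (v i) = n * inner ℝ l vbar := fun l => by
    rw [← inner_sum, hvbar, real_inner_smul_right]
  have hcenter : ∀ l, ∑ i, inner ℝ l (v i - vbar) = 0 := fun l => by
    simp only [inner_sub_right, Finset.sum_sub_distrib, hinner]
    simp
  -- the sample covariance operator, scaled by `n`
  let A : EuclideanSpace ℝ (Fin m) →ₗ[ℝ] EuclideanSpace ℝ (Fin m) :=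
    { toFun := fun l => ∑ i, inner ℝ l (v i - vbar) • v i
      map_add' := fun l l' => by simp [inner_add_left, add_smul, Finset.sum_add_distrib]
      map_smul' := fun r l => by simp [real_inner_smul_left, mul_smul, Finset.smul_sum] }
  have hAapp : ∀ l, A l = ∑ i, inner ℝ l (v i - vbar) • v i := fun _ => rfl
  have hAinner : ∀ l, inner ℝ l (A l) = ∑ i, inner ℝ l (v i - vbar) ^ 2 := fun l => by
    have h : ∀ i, inner ℝ l (v i - vbar) ^ 2
        = inner ℝ l (v i - vbar) * inner ℝ l (v i) - inner ℝ l (v i - vbar) * inner ℝ l vbar :=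
      fun i => by rw [← mul_sub, ← inner_sub_right, sq]
    rw [hAapp, inner_sum]
    simp only [h, Finset.sum_sub_distrib, ← Finset.sum_mul, hcenter, zero_mul, sub_zero,
      real_inner_smul_right]
  have hAcoer : ∀ l, n * (c * ‖l‖ ^ 2) ≤ inner ℝ l (A l) := fun l => by
    have h2 : ∑ i, inner ℝ l (v i - vbar) ^ 2
        = n * ((∑ i, inner ℝ l (v i) ^ 2) / n - inner ℝ l vbar ^ 2) := by
      simp only [inner_sub_right, sub_sq, Finset.sum_add_distrib, Finset.sum_sub_distrib,
        ← Finset.sum_mul, ← Finset.mul_sum, hinner]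
      simp only [Finset.sum_const, Finset.card_univ, Fintype.card_fin, nsmul_eq_mul]
      field_simp
      ring
    rw [hAinner, h2]
    exact mul_le_mul_of_nonneg_left (hcov l) hn'.le
  have hAinj : Function.Injective A := by
    refine (injective_iff_map_eq_zero A).2 fun l hl => ?_
    have h := hAcoer l
    rw [hl, inner_zero_right] at h
    have h0 : ‖l‖ ^ 2 ≤ 0 := by
      by_contra! hcon
      nlinarith [mul_pos hn' (mul_pos hc hcon)]
    exact norm_eq_zero.1 (pow_eq_zero_iff (two_ne_zero) |>.1 (le_antisymm h0 (sq_nonneg _)))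
  obtain ⟨l, hl⟩ := LinearMap.injective_iff_surjective.1 hAinj ((n : ℝ) • vbar)
  have hlv : inner ℝ l (A l) = n * inner ℝ l vbar := by rw [hl, real_inner_smul_right]
  have hlnorm : c * ‖l‖ ≤ ‖vbar‖ := by
    rcases (norm_nonneg l).eq_or_lt with h0 | h0
    · rw [← h0, mul_zero]; exact norm_nonneg _
    · have h := (hAcoer l).trans_eq hlv
      have h' := le_of_mul_le_mul_left h hn'
      have h'' := h'.trans (real_inner_le_norm l vbar)
      nlinarith
  set u : Fin n → ℝ := fun i => inner ℝ l (v i - vbar) with hu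
  have habs : ∀ i, |u i| ≤ 1 / 2 := fun i => by
    have h1 : |u i| ≤ ‖l‖ * (‖v i‖ + ‖vbar‖) :=
      (abs_real_inner_le_norm _ _).trans
        (mul_le_mul_of_nonneg_left (norm_sub_le _ _) (norm_nonneg _))
    have h2 := mul_le_mul_of_nonneg_right hlnorm
      (by positivity : (0 : ℝ) ≤ ‖v i‖ + ‖vbar‖)
    have h3 := hsmall i
    have h4 : c * |u i| ≤ c * (1 / 2) := by nlinarith
    exact le_of_mul_le_mul_left h4 hc
  have hupos : ∀ i, 0 < 1 + -u i := fun i => by linarith [(abs_le.1 (habs i)).2]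
  set p : Fin n → ℝ := fun i => (n : ℝ)⁻¹ * (1 + -u i) with hp
  have hsumu : ∑ i, u i = 0 := hcenter l
  have hpw : p ∈ weights g x θ := by
    refine ⟨fun i => mul_pos (inv_pos.2 hn') (hupos i), ?_, ?_⟩
    · simp only [hp, ← Finset.mul_sum, Finset.sum_add_distrib, Finset.sum_neg_distrib, hsumu]
      simp [hn'.ne']
    · have h : ∑ i, p i • v i = (n : ℝ)⁻¹ • (∑ i, v i - A l) := by
        rw [hAapp, ← Finset.sum_sub_distrib, Finset.smul_sum]
        refine Finset.sum_congr rfl fun i _ => ?_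
        simp only [hp, hu, mul_smul, add_smul, one_smul, neg_smul, sub_eq_add_neg]
      rw [h, hl, hvbar, sub_self, smul_zero]
  refine (W_le_of_mem_weights hpw).trans (EReal.coe_le_coe_iff.2 ?_)
  have hlogp : ∀ i, Real.log (p i) = -Real.log n + Real.log (1 + -u i) := fun i => by
    rw [hp, Real.log_mul (inv_pos.2 hn').ne' (hupos i).ne', Real.log_inv]
  have hlog := Finset.sum_le_sum fun i (_ : i ∈ Finset.univ) =>
    sub_two_mul_sq_le_log_one_add (y := -u i) (by rw [abs_neg]; exact habs i)
  simp only [Finset.sum_sub_distrib, Finset.sum_neg_distrib, hsumu, ← Finset.mul_sum,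
    neg_sq] at hlog
  have hsq : ∑ i, u i ^ 2 ≤ n * ‖vbar‖ ^ 2 / c := by
    rw [← hAinner l, hlv, mul_div_assoc]
    refine mul_le_mul_of_nonneg_left ?_ hn'.le
    rw [le_div_iff₀ hc]
    nlinarith [real_inner_le_norm l vbar, norm_nonneg vbar]
  simp only [hlogp, Finset.sum_add_distrib, Finset.sum_const, Finset.card_univ, Fintype.card_fin,
    nsmul_eq_mul]
  have : 2 * (n * ‖vbar‖ ^ 2) / c = 2 * (n * ‖vbar‖ ^ 2 / c) := by ring
  linarith

end

/-! ### The oscillation at infinity -/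

section

variable {Ω S : Type*} [MeasurableSpace Ω] {μ : Measure Ω}
  {X : ℕ → Ω → S} {q m : ℕ}
  {g : S → EuclideanSpace ℝ (Fin q) → EuclideanSpace ℝ (Fin m)}
  {Θ : Set (EuclideanSpace ℝ (Fin q))}

theorem oscAtInfty_antitone {k : ℕ} (h : S → EuclideanSpace ℝ (Fin q) → EuclideanSpace ℝ (Fin k))
    (Θ : Set (EuclideanSpace ℝ (Fin q))) (x : S) : Antitone (oscAtInfty h Θ x) := fun r s hrs => by
  have hsub : {θ ∈ Θ | s ≤ ‖θ‖} ⊆ {θ ∈ Θ | r ≤ ‖θ‖} := fun θ hθ => ⟨hθ.1, hrs.trans hθ.2⟩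
  exact (biSup_mono fun θ hθ => hsub hθ).trans
    (iSup₂_mono fun θ _ => biSup_mono fun θ' hθ' => hsub hθ')

theorem enorm_sub_le_oscAtInfty {k : ℕ}
    (h : S → EuclideanSpace ℝ (Fin q) → EuclideanSpace ℝ (Fin k)) (x : S) {r : ℝ}
    {θ θ' : EuclideanSpace ℝ (Fin q)} (hθ : θ ∈ {θ ∈ Θ | r ≤ ‖θ‖})
    (hθ' : θ' ∈ {θ ∈ Θ | r ≤ ‖θ‖}) : ‖h x θ - h x θ'‖ₑ ≤ oscAtInfty h Θ x r :=
  le_iSup₂_of_le θ hθ (le_iSup₂ (f := fun θ' (_ : θ' ∈ {θ ∈ Θ | r ≤ ‖θ‖}) => ‖h x θ - h x θ'‖ₑ)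
    θ' hθ')

theorem oscAtInfty_le_two_add {k : ℕ}
    (h : S → EuclideanSpace ℝ (Fin q) → EuclideanSpace ℝ (Fin k)) (x : S) (r : ℝ) :
    oscAtInfty h Θ x r ≤ 2 + 2 * ⨆ θ ∈ {θ ∈ Θ | r ≤ ‖θ‖}, ‖h x θ‖ₑ ^ 2 := by
  have hsq : ∀ a : ℝ≥0∞, a ≤ 1 + a ^ 2 := fun a => by
    rcases le_total a 1 with ha | ha
    · exact ha.trans le_self_add
    · exact (by simpa [sq] using mul_le_mul_right ha a : a ≤ a ^ 2).trans le_add_self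
  refine iSup₂_le fun θ hθ => iSup₂_le fun θ' hθ' => ?_
  have hle : ∀ η ∈ {θ ∈ Θ | r ≤ ‖θ‖},
      ‖h x η‖ₑ ≤ 1 + ⨆ θ ∈ {θ ∈ Θ | r ≤ ‖θ‖}, ‖h x θ‖ₑ ^ 2 := fun η hη =>
    (hsq _).trans (add_le_add le_rfl
      (le_iSup₂ (f := fun θ (_ : θ ∈ {θ ∈ Θ | r ≤ ‖θ‖}) => ‖h x θ‖ₑ ^ 2) η hη))
  refine (enorm_sub_le.trans (add_le_add (hle θ hθ) (hle θ' hθ'))).trans (le_of_eq ?_)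
  ring

/-! ### Lower bounds away from the true parameter -/

/-- Almost surely, `Wₙ` is at least of order `√n`, uniformly over the set `A` of parameters. The
constant may depend on the sample path. -/
def IsLargeOn (μ : Measure Ω) (X : ℕ → Ω → S)
    (g : S → EuclideanSpace ℝ (Fin q) → EuclideanSpace ℝ (Fin m))
    (A : Set (EuclideanSpace ℝ (Fin q))) : Prop :=
  ∀ᵐ ω ∂μ, ∃ c : ℝ, 0 < c ∧ ∀ᶠ n : ℕ in atTop, ∀ θ ∈ A,
    ((c * √n : ℝ) : EReal) ≤ W g (fun i : Fin n => X i ω) θ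

theorem isLargeOn_empty : IsLargeOn μ X g ∅ :=
  Eventually.of_forall fun _ => ⟨1, one_pos, Eventually.of_forall fun _ _ h => h.elim⟩

theorem IsLargeOn.mono {A B : Set (EuclideanSpace ℝ (Fin q))} (hAB : A ⊆ B)
    (hB : IsLargeOn μ X g B) : IsLargeOn μ X g A := by
  filter_upwards [hB] with ω ⟨c, hc, h⟩
  exact ⟨c, hc, h.mono fun n hn θ hθ => hn θ (hAB hθ)⟩

theorem IsLargeOn.union {A B : Set (EuclideanSpace ℝ (Fin q))} (hA : IsLargeOn μ X g A)
    (hB : IsLargeOn μ X g B) : IsLargeOn μ X g (A ∪ B) := by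
  filter_upwards [hA, hB] with ω ⟨c, hc, h⟩ ⟨d, hd, h'⟩
  refine ⟨min c d, lt_min hc hd, ?_⟩
  filter_upwards [h, h'] with n hn hn' θ hθ
  have key : ∀ e, min c d ≤ e →
      ((min c d * √n : ℝ) : EReal) ≤ ((e * √n : ℝ) : EReal) := fun e he =>
    EReal.coe_le_coe_iff.2 (mul_le_mul_of_nonneg_right he (Real.sqrt_nonneg _))
  rcases hθ with hθ | hθ
  · exact (key c (min_le_left _ _)).trans (hn θ hθ)
  · exact (key d (min_le_right _ _)).trans (hn' θ hθ)

variable [MeasurableSpace S] {F : Measure S}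

/-- An almost sure property of a single observation holds along almost every sample path. -/
theorem ae_forall_of_hasLaw (hlaw : ∀ i, HasLaw (X i) F μ) {P : S → Prop}
    (hP : ∀ᵐ x ∂F, P x) : ∀ᵐ ω ∂μ, ∀ i, P (X i ω) := by
  refine ae_all_iff.2 fun i => ?_
  rw [← (hlaw i).map_eq] at hP
  exact ae_of_ae_map (hlaw i).aemeasurable hP

/-- Separation criterion: `Wₙ` is of order `√n` on `A` as soon as some linear functionals of the
estimating function have, over `A`, a common lower envelope `Y` with positive mean and an
integrable common upper bound `Q` on their squares. -/
theorem isLargeOn_of_envelope (hlaw : ∀ i, HasLaw (X i) F μ) (hindep : iIndepFun X μ)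
    {A : Set (EuclideanSpace ℝ (Fin q))}
    (L : EuclideanSpace ℝ (Fin q) → EuclideanSpace ℝ (Fin m) →L[ℝ] ℝ) {Y Q : S → ℝ}
    (hY : Integrable Y F) (hQ : Integrable Q F) (hpos : 0 < ∫ x, Y x ∂F)
    (hae : ∀ᵐ x ∂F, ∀ θ ∈ A, Y x ≤ L θ (g x θ) ∧ L θ (g x θ) ^ 2 ≤ Q x) :
    IsLargeOn μ X g A := by
  filter_upwards [ae_tendsto_average hlaw hindep hY, ae_tendsto_average hlaw hindep hQ,
    ae_forall_of_hasLaw hlaw hae] with ω hYlim hQlim hω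
  set a : ℝ := (∫ x, Y x ∂F) / 2 with ha
  set b : ℝ := |∫ x, Q x ∂F| + 1 with hb
  have ha0 : 0 < a := half_pos hpos
  have hb0 : 0 < b := by positivity
  have hc0 : 0 < a / (2 * √b) := div_pos ha0 (by positivity)
  refine ⟨a / (2 * √b) / 2, half_pos hc0, ?_⟩
  have hsqrt : Tendsto (fun n : ℕ => a / (2 * √b) / 2 * √(n : ℝ)) atTop atTop :=
    (Real.tendsto_sqrt_atTop.comp tendsto_natCast_atTop_atTop).const_mul_atTop (half_pos hc0)
  filter_upwards [hYlim.eventually (lt_mem_nhds (half_lt_self hpos)),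
    hQlim.eventually_lt_const (u := b) (by linarith [le_abs_self (∫ x, Q x ∂F)]),
    eventually_gt_atTop 0, hsqrt.eventually_ge_atTop (1 / 2)] with n h1 h2 hn h3 θ hθ
  have hn' : (0 : ℝ) < n := by exact_mod_cast hn
  rw [lt_div_iff₀ hn', Finset.sum_range] at h1
  rw [div_lt_iff₀ hn', Finset.sum_range] at h2
  refine le_trans (EReal.coe_le_coe_iff.2 ?_) (sqrt_le_W (a := a) hn hb0 (L θ)
    (h1.le.trans (Finset.sum_le_sum fun i _ => (hω i θ hθ).1))
    ((Finset.sum_le_sum fun (i : Fin n) _ => (hω i θ hθ).2).trans h2.le))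
  linarith

theorem exists_norm_le_one_inner_eq_norm {E : Type*} [NormedAddCommGroup E]
    [InnerProductSpace ℝ E] (v : E) : ∃ u : E, ‖u‖ ≤ 1 ∧ inner ℝ u v = ‖v‖ := by
  rcases eq_or_ne v 0 with rfl | hv
  · exact ⟨0, by simp, by simp⟩
  · have hv' : ‖v‖ ≠ 0 := norm_ne_zero_iff.2 hv
    refine ⟨‖v‖⁻¹ • v, ?_, ?_⟩
    · rw [norm_smul, norm_inv, norm_norm, inv_mul_cancel₀ hv']
    · rw [real_inner_smul_left, real_inner_self_eq_norm_sq]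
      field_simp

theorem inner_sq_le_norm_sq {E : Type*} [NormedAddCommGroup E] [InnerProductSpace ℝ E] {u : E}
    (hu : ‖u‖ ≤ 1) (v : E) : inner ℝ u v ^ 2 ≤ ‖v‖ ^ 2 := by
  refine sq_le_sq' ?_ ?_ <;>
  · have h := abs_le.1 (abs_real_inner_le_norm u v)
    nlinarith [norm_nonneg v, h.1, h.2]

theorem inner_sub_norm_le_inner {E : Type*} [NormedAddCommGroup E] [InnerProductSpace ℝ E] {u : E}
    (hu : ‖u‖ ≤ 1) (v w : E) : inner ℝ u w - ‖v - w‖ ≤ inner ℝ u v := by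
  have h := (abs_le.1 (abs_real_inner_le_norm u (v - w))).1
  rw [inner_sub_right] at h
  nlinarith [norm_nonneg (v - w)]

/-- Near a parameter that does not solve the moment equation the functional in the direction of the
mean separates, by the Lipschitz condition. -/
theorem exists_mem_nhds_isLargeOn [IsProbabilityMeasure F] (hlaw : ∀ i, HasLaw (X i) F μ)
    (hindep : iIndepFun X μ) (h2 : C2 F g Θ) (h3 : C3 F g Θ) (h4 : IsClosed Θ)
    {θ₀ : EuclideanSpace ℝ (Fin q)} (hθ₀ : θ₀ ∈ Θ) (hne : ∫ x, g x θ₀ ∂F ≠ 0) :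
    ∃ U ∈ 𝓝 θ₀, IsLargeOn μ X g (U ∩ Θ) := by
  obtain ⟨G, hG, hLip⟩ := h3 (Metric.closedBall θ₀ 1 ∩ Θ) Set.inter_subset_right
    ((isCompact_closedBall θ₀ 1).inter_right h4)
  have hg2 : MemLp (fun x => g x θ₀) 2 F := (h2 θ₀ hθ₀).1.mono_exponent (by norm_num)
  have hgint : Integrable (fun x => g x θ₀) F := hg2.integrable (by norm_num)
  have hGint : Integrable (fun x => |G x|) F := (hG.integrable (by norm_num)).abs
  set v := ∫ x, g x θ₀ ∂F with hv
  obtain ⟨u, hu, huv⟩ := exists_norm_le_one_inner_eq_norm v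
  have hv0 : 0 < ‖v‖ := norm_pos_iff.2 hne
  have hI0 : 0 ≤ ∫ x, |G x| ∂F := integral_nonneg fun x => abs_nonneg _
  -- a radius at which the Lipschitz error has mean smaller than `‖v‖`
  set δ : ℝ := min 1 (‖v‖ / (2 * ((∫ x, |G x| ∂F) + 1))) with hδ
  have hδ0 : 0 < δ := lt_min one_pos (by positivity)
  have hδ1 : δ ≤ 1 := min_le_left _ _
  have hδI : δ * ∫ x, |G x| ∂F < ‖v‖ := by
    have h : δ ≤ ‖v‖ / (2 * ((∫ x, |G x| ∂F) + 1)) := min_le_right _ _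
    rw [le_div_iff₀ (by positivity)] at h
    nlinarith
  refine ⟨Metric.closedBall θ₀ δ, Metric.closedBall_mem_nhds _ hδ0, ?_⟩
  have hinner : Integrable (fun x => inner ℝ u (g x θ₀)) F := hgint.const_inner u
  refine isLargeOn_of_envelope hlaw hindep (fun _ => innerSL ℝ u)
    (Y := fun x => inner ℝ u (g x θ₀) - δ * |G x|) (Q := fun x => (‖g x θ₀‖ + |G x|) ^ 2)
    (hinner.sub (hGint.const_mul δ)) (hg2.norm.add hG.abs).integrable_sq ?_ ?_
  · have h : ∫ x, inner ℝ u (g x θ₀) ∂F = ‖v‖ := by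
      rw [← huv]
      exact (innerSL ℝ u).integral_comp_comm hgint
    rw [integral_sub hinner (hGint.const_mul δ), h, integral_const_mul]
    linarith
  · filter_upwards [hLip] with x hx θ hθ
    have hdist : ‖θ - θ₀‖ ≤ δ := by simpa [dist_eq_norm] using hθ.1
    have hnorm : ‖g x θ - g x θ₀‖ ≤ δ * |G x| := by
      refine (hx θ₀ ⟨Metric.mem_closedBall_self zero_le_one, hθ₀⟩ θ
        ⟨Metric.closedBall_subset_closedBall hδ1 hθ.1, hθ.2⟩).trans ?_
      rw [mul_comm δ]
      exact (mul_le_mul_of_nonneg_right (le_abs_self _) (norm_nonneg _)).trans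
        (mul_le_mul_of_nonneg_left hdist (abs_nonneg _))
    simp only [innerSL_apply_apply]
    refine ⟨by linarith [inner_sub_norm_le_inner hu (g x θ) (g x θ₀)],
      (inner_sq_le_norm_sq hu _).trans ?_⟩
    have h5 : ‖g x θ‖ ≤ ‖g x θ₀‖ + ‖g x θ - g x θ₀‖ := by
      simpa using norm_add_le (g x θ₀) (g x θ - g x θ₀)
    have h6 : δ * |G x| ≤ |G x| := mul_le_of_le_one_left (abs_nonneg _) hδ1
    exact pow_le_pow_left₀ (norm_nonneg _) (by linarith) 2

theorem isLargeOn_of_isCompact [IsProbabilityMeasure F] (hlaw : ∀ i, HasLaw (X i) F μ)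
    (hindep : iIndepFun X μ) (h2 : C2 F g Θ) (h3 : C3 F g Θ) (h4 : IsClosed Θ)
    {K : Set (EuclideanSpace ℝ (Fin q))} (hK : IsCompact K) (hKΘ : K ⊆ Θ)
    (hne : ∀ θ ∈ K, ∫ x, g x θ ∂F ≠ 0) : IsLargeOn μ X g K := by
  refine hK.induction_on (p := IsLargeOn μ X g) isLargeOn_empty (fun s t hst ht => ht.mono hst)
    (fun s t hs ht => hs.union ht) fun θ hθ => ?_
  obtain ⟨U, hU, hlarge⟩ := exists_mem_nhds_isLargeOn hlaw hindep h2 h3 h4 (hKΘ hθ) (hne θ hθ)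
  exact ⟨U ∩ K, inter_mem (mem_nhdsWithin_of_mem_nhds hU) self_mem_nhdsWithin,
    hlarge.mono (Set.inter_subset_inter_right U hKΘ)⟩

/-! ### Measurable envelopes at infinity -/

/-- A supremum over an uncountable separable set of parameters is almost everywhere measurable when
the sample paths are almost surely continuous on that set. -/
theorem aemeasurable_biSup_of_continuousOn {E : Type*} [TopologicalSpace E]
    [TopologicalSpace.PseudoMetrizableSpace E] [SecondCountableTopology E] {A : Set E}
    {f : S → E → ℝ≥0∞} (hcont : ∀ᵐ x ∂F, ContinuousOn (f x) A)
    (hmeas : ∀ e ∈ A, AEMeasurable (fun x => f x e) F) :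
    AEMeasurable (fun x => ⨆ e ∈ A, f x e) F := by
  obtain ⟨t, htA, htc, hdense⟩ :=
    (TopologicalSpace.IsSeparable.of_separableSpace A).exists_countable_dense_subset
  refine (AEMeasurable.biSup t htc (f := fun e x => f x e)
    fun e he => hmeas e (htA he)).congr ?_
  filter_upwards [hcont] with x hx
  refine le_antisymm (biSup_mono fun e he => htA he) (iSup₂_le fun e he => ?_)
  have hne : (𝓝[t] e).NeBot := mem_closure_iff_nhdsWithin_neBot.1 (hdense he)
  refine le_of_tendsto ((hx e he).mono_left (nhdsWithin_mono e htA)) ?_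
  filter_upwards [self_mem_nhdsWithin] with e' he'
  exact le_iSup₂ (f := fun e (_ : e ∈ t) => f x e) e' he'

/-- The local Lipschitz condition makes the estimating function continuous on `Θ`. -/
theorem C3.ae_continuousOn (h3 : C3 F g Θ) (h4 : IsClosed Θ) :
    ∀ᵐ x ∂F, ContinuousOn (g x) Θ := by
  choose G _ hLip using fun N : ℕ => h3 (Metric.closedBall 0 (N : ℝ) ∩ Θ) Set.inter_subset_right
    ((isCompact_closedBall 0 (N : ℝ)).inter_right h4)
  filter_upwards [ae_all_iff.2 hLip] with x hx θ hθ
  obtain ⟨N, hN⟩ := exists_nat_gt ‖θ‖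
  have hball : Metric.closedBall (0 : EuclideanSpace ℝ (Fin q)) (N : ℝ) ∈ 𝓝 θ :=
    Filter.mem_of_superset (Metric.isOpen_ball.mem_nhds (by simpa using hN))
      Metric.ball_subset_closedBall
  have hlip : LipschitzOnWith (G N x).toNNReal (g x)
      (Metric.closedBall (0 : EuclideanSpace ℝ (Fin q)) (N : ℝ) ∩ Θ) :=
    LipschitzOnWith.of_dist_le_mul fun a ha b hb => by
      rw [dist_eq_norm, dist_eq_norm]
      exact (hx N b hb a ha).trans
        (mul_le_mul_of_nonneg_right (Real.le_coe_toNNReal _) (norm_nonneg _))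
  refine (hlip.continuousOn θ ⟨mem_of_mem_nhds hball, hθ⟩).mono_of_mem_nhdsWithin ?_
  exact inter_mem (mem_nhdsWithin_of_mem_nhds hball) self_mem_nhdsWithin

theorem aemeasurable_oscAtInfty {k : ℕ}
    {h : S → EuclideanSpace ℝ (Fin q) → EuclideanSpace ℝ (Fin k)}
    (hcont : ∀ᵐ x ∂F, ContinuousOn (h x) Θ)
    (hmeas : ∀ θ ∈ Θ, AEStronglyMeasurable (fun x => h x θ) F) (r : ℝ) :
    AEMeasurable (fun x => oscAtInfty h Θ x r) F := by
  set A := {θ ∈ Θ | r ≤ ‖θ‖} with hA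
  have hAΘ : A ⊆ Θ := Set.sep_subset _ _
  have key := aemeasurable_biSup_of_continuousOn (F := F) (A := A ×ˢ A)
    (f := fun x e => ‖h x e.1 - h x e.2‖ₑ) ?_ fun e he =>
      ((hmeas _ (hAΘ he.1)).sub (hmeas _ (hAΘ he.2))).enorm
  · simp only [biSup_prod] at key
    exact key
  · filter_upwards [hcont] with x hx
    exact continuous_enorm.comp_continuousOn
      (((hx.mono hAΘ).comp continuousOn_fst fun e he => he.1).sub
        ((hx.mono hAΘ).comp continuousOn_snd fun e he => he.2))

/-- Near infinity `Wₙ` is of order `√n`: there the scaled function `h` is close to `h(·; θ₀)` for a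
single far-away `θ₀`, whose mean is bounded away from zero. -/
theorem C5.exists_isLargeOn [IsProbabilityMeasure F] (h5 : C5 F g Θ)
    (hlaw : ∀ i, HasLaw (X i) F μ) (hindep : iIndepFun X μ) (h2 : C2 F g Θ) (h3 : C3 F g Θ)
    (h4 : IsClosed Θ) : ∃ R : ℝ, IsLargeOn μ X g {θ ∈ Θ | R ≤ ‖θ‖} := by
  obtain ⟨k, b, h, hb, hh, ⟨r₀, hr₀⟩, hlim, hosc⟩ := h5
  have hgint : ∀ θ ∈ Θ, Integrable (fun x => g x θ) F := fun θ hθ =>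
    (h2 θ hθ).1.integrable (by norm_num)
  have hhint : ∀ θ ∈ Θ, Integrable (fun x => h x θ) F := fun θ hθ => by
    simpa only [hh] using (b θ).integrable_comp (hgint θ hθ)
  have hcont : ∀ᵐ x ∂F, ContinuousOn (h x) Θ := by
    filter_upwards [h3.ae_continuousOn h4] with x hx
    rw [show h x = fun θ => b θ (g x θ) from funext (hh x)]
    exact hb.clm_apply hx
  have hmeas : ∀ r, AEMeasurable (fun x => oscAtInfty h Θ x r) F :=
    aemeasurable_oscAtInfty hcont fun θ hθ => (hhint θ hθ).1
  obtain ⟨c, hc0, hc⟩ := exists_between hlim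
  have hctop : c ≠ ∞ := hc.ne_top
  have hev := eventually_lt_of_lt_liminf hc
  rw [eventually_inf_principal] at hev
  obtain ⟨r₁, -, hr₁⟩ := hasBasis_cobounded_norm.eventually_iff.1 hev
  obtain ⟨N, hN⟩ := exists_nat_ge (max r₀ r₁)
  -- the mean oscillation tends to zero, by dominated convergence
  have hdom : ∀ r, r₀ ≤ r → ∫⁻ x, ⨆ θ ∈ {θ ∈ Θ | r ≤ ‖θ‖}, ‖h x θ‖ₑ ^ 2 ∂F ≠ ∞ := fun r hr =>
    ((lintegral_mono fun x => biSup_mono fun θ hθ => ⟨hθ.1, hr.trans hθ.2⟩).trans_lt hr₀).ne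
  have hoscfin : ∀ r, r₀ ≤ r → ∫⁻ x, oscAtInfty h Θ x r ∂F ≠ ∞ := fun r hr => by
    refine ((lintegral_mono fun x => oscAtInfty_le_two_add h x r).trans_lt ?_).ne
    rw [lintegral_add_left measurable_const, lintegral_const_mul' _ _ (by norm_num)]
    simpa using ENNReal.mul_lt_top (by norm_num) (hdom r hr).lt_top
  have hinf : ⨅ n : ℕ, ∫⁻ x, oscAtInfty h Θ x ((n + N : ℕ) : ℝ) ∂F = 0 := by
    rw [← lintegral_iInf' (fun n => hmeas _)
      (Eventually.of_forall fun x i j hij => oscAtInfty_antitone h Θ x (by gcongr))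
      (hoscfin _ (by simpa using (le_max_left _ _).trans hN))]
    refine le_antisymm (le_trans (lintegral_mono fun x => le_iInf fun r => ?_) hosc.le) zero_le
    obtain ⟨n, hn⟩ := exists_nat_ge r
    exact iInf_le_of_le n (oscAtInfty_antitone h Θ x
      (hn.trans (by exact_mod_cast Nat.le_add_right n N)))
  obtain ⟨n, hn⟩ := iInf_lt_iff.1 (hinf.trans_lt hc0)
  set R : ℝ := ((n + N : ℕ) : ℝ) with hR
  have hNR : (N : ℝ) ≤ R := by rw [hR]; exact_mod_cast Nat.le_add_left N n
  have hr₀R : r₀ ≤ R := ((le_max_left _ _).trans hN).trans hNR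
  have hr₁R : r₁ ≤ R := ((le_max_right _ _).trans hN).trans hNR
  refine ⟨R, ?_⟩
  rcases Set.eq_empty_or_nonempty {θ ∈ Θ | R ≤ ‖θ‖} with hempty | ⟨θ₀, hθ₀⟩
  · rw [hempty]; exact isLargeOn_empty
  have hmean : c < ‖∫ x, h x θ₀ ∂F‖ₑ := hr₁ (hr₁R.trans hθ₀.2) hθ₀.1
  set v := ∫ x, h x θ₀ ∂F with hv
  obtain ⟨u, hu, huv⟩ := exists_norm_le_one_inner_eq_norm v
  have hQmeas : AEMeasurable (fun x => ⨆ θ ∈ {θ ∈ Θ | R ≤ ‖θ‖}, ‖h x θ‖ₑ ^ 2) F := by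
    refine aemeasurable_biSup_of_continuousOn (f := fun x θ => ‖h x θ‖ₑ ^ 2) ?_ fun θ hθ =>
      (hhint θ hθ.1).1.enorm.pow_const 2
    filter_upwards [hcont] with x hx
    exact (ENNReal.continuous_pow 2).comp_continuousOn
      (continuous_enorm.comp_continuousOn (hx.mono (Set.sep_subset _ _)))
  have hinner : Integrable (fun x => inner ℝ u (h x θ₀)) F := (hhint θ₀ hθ₀.1).const_inner u
  have hoscint : Integrable (fun x => (oscAtInfty h Θ x R).toReal) F :=
    integrable_toReal_of_lintegral_ne_top (hmeas R) (hoscfin R hr₀R)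
  refine isLargeOn_of_envelope hlaw hindep (fun θ => (innerSL ℝ u).comp (b θ))
    (Y := fun x => inner ℝ u (h x θ₀) - (oscAtInfty h Θ x R).toReal)
    (Q := fun x => (⨆ θ ∈ {θ ∈ Θ | R ≤ ‖θ‖}, ‖h x θ‖ₑ ^ 2).toReal)
    (hinner.sub hoscint) (integrable_toReal_of_lintegral_ne_top hQmeas (hdom R hr₀R)) ?_ ?_
  · have hI : ∫ x, inner ℝ u (h x θ₀) ∂F = ‖v‖ := by
      rw [← huv]
      exact (innerSL ℝ u).integral_comp_comm (hhint θ₀ hθ₀.1)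
    rw [integral_sub hinner hoscint, hI, integral_toReal (hmeas R)
      (ae_lt_top' (hmeas R) (hoscfin R hr₀R)), sub_pos, ← toReal_enorm]
    exact (ENNReal.toReal_lt_toReal (hoscfin R hr₀R) enorm_ne_top).2 (hn.trans hmean)
  · filter_upwards [ae_lt_top' (hmeas R) (hoscfin R hr₀R),
      ae_lt_top' hQmeas (hdom R hr₀R)] with x hx hx' θ hθ
    simp only [ContinuousLinearMap.comp_apply, innerSL_apply_apply, ← hh]
    constructor
    · have h1 : ‖h x θ - h x θ₀‖ ≤ (oscAtInfty h Θ x R).toReal := by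
        rw [← toReal_enorm]
        exact ENNReal.toReal_mono hx.ne (enorm_sub_le_oscAtInfty h x hθ hθ₀)
      linarith [inner_sub_norm_le_inner hu (h x θ) (h x θ₀)]
    · refine (inner_sq_le_norm_sq hu _).trans ?_
      rw [← toReal_enorm, ← ENNReal.toReal_pow]
      exact ENNReal.toReal_mono hx'.ne
        (le_iSup₂ (f := fun θ (_ : θ ∈ {θ ∈ Θ | R ≤ ‖θ‖}) => ‖h x θ‖ₑ ^ 2) θ hθ)

end

/-! ### Upper bound at the true parameter -/

section

variable {Ω S : Type*} [MeasurableSpace Ω] [MeasurableSpace S] {μ : Measure Ω} {F : Measure S}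
  {X : ℕ → Ω → S} {q m : ℕ}
  {g : S → EuclideanSpace ℝ (Fin q) → EuclideanSpace ℝ (Fin m)}

theorem norm_pow_three_le (v : EuclideanSpace ℝ (Fin m)) :
    ‖v‖ ^ 3 ≤ (m : ℝ) ^ 2 * ∑ j, |v j| ^ 3 := by
  have h1 : ‖v‖ ≤ ∑ j, |v j| := by
    conv_lhs => rw [← (EuclideanSpace.basisFun (Fin m) ℝ).sum_repr v]
    refine (norm_sum_le _ _).trans (le_of_eq (Finset.sum_congr rfl fun j _ => ?_))
    simp [norm_smul]
  rcases Nat.eq_zero_or_pos m with rfl | hm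
  · have h0 : ‖v‖ = 0 := le_antisymm (by simpa using h1) (norm_nonneg v)
    simp [h0]
  · have hm' : (0 : ℝ) < (m : ℝ) ^ 2 := by positivity
    have h2 := pow_sum_div_card_le_sum_pow (s := Finset.univ) (f := fun j => |v j|)
      (fun j _ => abs_nonneg _) 2
    rw [Finset.card_univ, Fintype.card_fin, div_le_iff₀ hm', mul_comm] at h2
    exact (pow_le_pow_left₀ (norm_nonneg v) h1 3).trans h2

/-- A positive definite matrix is bounded below by a multiple of the identity. -/
theorem exists_pos_mul_norm_sq_le_of_posDef {M : Matrix (Fin m) (Fin m) ℝ} (hM : M.PosDef) :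
    ∃ c : ℝ, 0 < c ∧ ∀ l : EuclideanSpace ℝ (Fin m),
      c * ‖l‖ ^ 2 ≤ ∑ j, ∑ k, l j * l k * M j k := by
  set Q : EuclideanSpace ℝ (Fin m) → ℝ := fun l => ∑ j, ∑ k, l j * l k * M j k with hQ
  have hpos : ∀ l, l ≠ 0 → 0 < Q l := fun l hl => by
    have h := hM.dotProduct_mulVec_pos (x := l.ofLp) (by simpa using hl)
    refine h.trans_eq ?_
    simp only [hQ, dotProduct, Matrix.mulVec, star_trivial, Finset.mul_sum]
    exact Finset.sum_congr rfl fun j _ => Finset.sum_congr rfl fun k _ => by ring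
  have hhom : ∀ (r : ℝ) l, Q (r • l) = r ^ 2 * Q l := fun r l => by
    simp only [hQ, Finset.mul_sum, PiLp.smul_apply, smul_eq_mul]
    exact Finset.sum_congr rfl fun j _ => Finset.sum_congr rfl fun k _ => by ring
  have hcont : Continuous Q := by fun_prop
  -- minimize over the unit sphere
  rcases (Metric.sphere (0 : EuclideanSpace ℝ (Fin m)) 1).eq_empty_or_nonempty with he | hne
  · refine ⟨1, one_pos, fun l => ?_⟩
    have hl : l = 0 := by
      by_contra hl
      have : ‖l‖⁻¹ • l ∈ Metric.sphere (0 : EuclideanSpace ℝ (Fin m)) 1 := by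
        simp [norm_smul, norm_ne_zero_iff.2 hl]
      rwa [he] at this
    simp [hl]
  · obtain ⟨l₀, hl₀, hmin⟩ := (isCompact_sphere (0 : EuclideanSpace ℝ (Fin m)) 1).exists_isMinOn
      hne hcont.continuousOn
    have hl₀' : l₀ ≠ 0 := fun h => by simp [h] at hl₀
    refine ⟨Q l₀, hpos l₀ hl₀', fun l => ?_⟩
    rcases eq_or_ne l 0 with rfl | hl
    · simp
    · have hn : ‖l‖ ≠ 0 := norm_ne_zero_iff.2 hl
      have h := hmin (show ‖l‖⁻¹ • l ∈ Metric.sphere (0 : EuclideanSpace ℝ (Fin m)) 1 by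
        simp [norm_smul, hn])
      simp only [Set.mem_ofPred_eq, hhom] at h
      have h' := mul_le_mul_of_nonneg_right h (sq_nonneg ‖l‖)
      have e : (‖l‖⁻¹) ^ 2 * Q l * ‖l‖ ^ 2 = Q l := by field_simp
      exact h'.trans_eq e

/-- At a solution of the moment equation `Wₙ = o(√n)`. The sample mean is `o(n ^ (-1/3))` and the
largest observation `O(n ^ (1/3))` by the third moment, so that `W_le_mul_norm_sq` applies. -/
theorem ae_eventually_W_le [IsProbabilityMeasure μ] [IsProbabilityMeasure F]
    (hlaw : ∀ i, HasLaw (X i) F μ) (hindep : iIndepFun X μ) {θ : EuclideanSpace ℝ (Fin q)}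
    (h3 : MemLp (fun x => g x θ) 3 F)
    (hpd : (Matrix.of fun i j : Fin m => ∫ x, g x θ i * g x θ j ∂F).PosDef)
    (hmean : ∫ x, g x θ ∂F = 0) :
    ∀ᵐ ω ∂μ, ∀ ε : ℝ, 0 < ε → ∀ᶠ n : ℕ in atTop,
      W g (fun i : Fin n => X i ω) θ ≤ ((ε * √n : ℝ) : EReal) := by
  have h2 : MemLp (fun x => g x θ) 2 F := h3.mono_exponent (by norm_num)
  have h2j : ∀ j, MemLp (fun x => g x θ j) 2 F := fun j => h2.eval_piLp j
  have hmeanj : ∀ j, ∫ x, g x θ j ∂F = 0 := fun j => by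
    rw [← eval_integral_piLp (fun j => (h2j j).integrable (by norm_num)), hmean]
    rfl
  have hcube : Integrable (fun x => ‖g x θ‖ ^ 3) F := h3.integrable_norm_pow (p := 3) (by norm_num)
  have hrate := ae_all_iff.2 fun j => ae_tendsto_mul_average_pow_three hlaw hindep (h2j j) (hmeanj j)
  have hmat := ae_all_iff.2 fun j => ae_all_iff.2 fun k =>
    ae_tendsto_average hlaw hindep ((h2j j).integrable_mul (h2j k))
  obtain ⟨c, hc, hcoer⟩ := exists_pos_mul_norm_sq_le_of_posDef hpd
  filter_upwards [hrate, hmat, ae_tendsto_average hlaw hindep hcube] with ω hrate hmat hthird ε hε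
  set v : ℕ → EuclideanSpace ℝ (Fin m) := fun i => g (X i ω) θ with hv
  set w : ℕ → EuclideanSpace ℝ (Fin m) := fun n => (n : ℝ)⁻¹ • ∑ i ∈ Finset.range n, v i with hw
  have hwj : ∀ n j, w n j = (∑ i ∈ Finset.range n, v i j) / n := fun n j => by
    simp [hw, div_eq_inv_mul]
  have hT : Tendsto (fun n : ℕ => (n : ℝ) * ‖w n‖ ^ 3) atTop (𝓝 0) := by
    have hsum : Tendsto (fun n : ℕ => (m : ℝ) ^ 2 * ∑ j, (n : ℝ) * |w n j| ^ 3) atTop (𝓝 0) := by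
      simp only [hwj]
      simpa using (tendsto_finsetSum Finset.univ fun j _ => hrate j).const_mul ((m : ℝ) ^ 2)
    refine squeeze_zero (fun n => by positivity) (fun n => ?_) hsum
    rw [← Finset.mul_sum, mul_left_comm]
    exact mul_le_mul_of_nonneg_left (norm_pow_three_le _) n.cast_nonneg
  have hw0 : Tendsto (fun n => ‖w n‖) atTop (𝓝 0) := by
    refine tendsto_order.2 ⟨fun a ha => Eventually.of_forall fun n => ha.trans_le (norm_nonneg _),
      fun a ha => ?_⟩
    filter_upwards [hT.eventually_lt_const (pow_pos ha 3), eventually_ge_atTop 1] with n hn hn1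
    have hn1' : (1 : ℝ) ≤ n := by exact_mod_cast hn1
    exact lt_of_pow_lt_pow_left₀ 3 ha.le
      ((le_mul_of_one_le_left (by positivity) hn1').trans_lt hn)
  set M : Fin m → Fin m → ℝ := fun j k => ∫ x, g x θ j * g x θ k ∂F with hM
  set Mn : ℕ → Fin m → Fin m → ℝ := fun n j k => (∑ i ∈ Finset.range n, v i j * v i k) / n with hMn
  set K : ℝ := ∫ x, ‖g x θ‖ ^ 3 ∂F with hK
  have hK0 : 0 ≤ K := integral_nonneg fun x => by positivity
  have herr : Tendsto (fun n => ∑ j, ∑ k, |Mn n j k - M j k| + ‖w n‖ ^ 2) atTop (𝓝 0) := by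
    have h : ∀ j k, Tendsto (fun n => |Mn n j k - M j k|) atTop (𝓝 0) := fun j k => by
      have h : Tendsto (fun n => Mn n j k) atTop (𝓝 (M j k)) := hmat j k
      simpa using (h.sub_const (M j k)).abs
    simpa using (tendsto_finsetSum Finset.univ fun j _ =>
      tendsto_finsetSum Finset.univ fun k _ => h j k).add (hw0.pow 2)
  have hTK : Tendsto (fun n : ℕ => (n : ℝ) * ‖w n‖ ^ 3 * (K + 1)) atTop (𝓝 0) := by
    simpa using hT.mul_const (K + 1)
  have hTw : Tendsto (fun n : ℕ => (n : ℝ) * ‖w n‖ ^ 3 * ‖w n‖) atTop (𝓝 0) := by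
    simpa using hT.mul hw0
  have hww : Tendsto (fun n : ℕ => ‖w n‖ * ‖w n‖) atTop (𝓝 0) := by
    simpa using hw0.mul hw0
  filter_upwards [eventually_gt_atTop 0, herr.eventually_lt_const (half_pos hc),
    hTK.eventually_lt_const (u := (c / 8) ^ 3) (by positivity),
    hTw.eventually_lt_const (u := (ε * c / 4) ^ 2) (by positivity),
    hww.eventually_lt_const (u := c / 8) (by positivity),
    hthird.eventually_lt_const (lt_add_one K)] with n hn herr hTK hTw hww hthird
  have hn' : (0 : ℝ) < n := by exact_mod_cast hn
  have hbar : ∑ i : Fin n, g (X i ω) θ = (n : ℝ) • w n := by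
    rw [hw, smul_inv_smul₀ hn'.ne', Finset.sum_range]
  -- coercivity of the sample covariance, with half of the constant
  have hcov : ∀ l : EuclideanSpace ℝ (Fin m),
      c / 2 * ‖l‖ ^ 2 ≤ (∑ i : Fin n, inner ℝ l (g (X i ω) θ) ^ 2) / n - inner ℝ l (w n) ^ 2 := by
    intro l
    have hquad : (∑ i : Fin n, inner ℝ l (g (X i ω) θ) ^ 2) / n
        = ∑ j, ∑ k, l j * l k * Mn n j k := by
      have h : ∀ i, inner ℝ l (v i) ^ 2 = ∑ j, ∑ k, l j * l k * (v i j * v i k) := fun i => by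
        rw [sq, PiLp.inner_apply, Finset.sum_mul_sum]
        refine Finset.sum_congr rfl fun j _ => Finset.sum_congr rfl fun k _ => ?_
        simp only [RCLike.inner_apply, conj_trivial]
        ring
      rw [← Finset.sum_range fun i => inner ℝ l (v i) ^ 2]
      simp only [h, hMn]
      rw [Finset.sum_comm, Finset.sum_div]
      refine Finset.sum_congr rfl fun j _ => ?_
      rw [Finset.sum_comm, Finset.sum_div]
      refine Finset.sum_congr rfl fun k _ => ?_
      rw [← Finset.mul_sum, mul_div_assoc]
    have hdiff : ∑ j, ∑ k, l j * l k * M j k - ∑ j, ∑ k, l j * l k * Mn n j k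
        ≤ ‖l‖ ^ 2 * ∑ j, ∑ k, |Mn n j k - M j k| := by
      rw [← Finset.sum_sub_distrib, Finset.mul_sum]
      refine Finset.sum_le_sum fun j _ => ?_
      rw [← Finset.sum_sub_distrib, Finset.mul_sum]
      refine Finset.sum_le_sum fun k _ => ?_
      rw [← mul_sub, abs_sub_comm]
      refine (le_abs_self _).trans ?_
      rw [abs_mul, abs_mul, sq]
      have hle : ∀ i, |l i| ≤ ‖l‖ := fun i => PiLp.norm_apply_le l i
      exact mul_le_mul_of_nonneg_right
        (mul_le_mul (hle j) (hle k) (abs_nonneg _) (norm_nonneg _)) (abs_nonneg _)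
    have hin : inner ℝ l (w n) ^ 2 ≤ ‖l‖ ^ 2 * ‖w n‖ ^ 2 := by
      rw [← mul_pow, ← sq_abs]
      exact pow_le_pow_left₀ (abs_nonneg _) (abs_real_inner_le_norm _ _) 2
    have hc' := hcoer l
    simp only [Matrix.of_apply] at hc'
    have h5 := mul_le_mul_of_nonneg_left herr.le (sq_nonneg ‖l‖)
    rw [hquad]
    nlinarith
  have hsmall : ∀ i : Fin n, ‖w n‖ * (‖g (X i ω) θ‖ + ‖w n‖) ≤ c / 2 / 2 := by
    intro i
    rw [div_lt_iff₀ hn', Finset.sum_range] at hthird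
    have h6 : ‖g (X i ω) θ‖ ^ 3 ≤ (K + 1) * n :=
      (Finset.single_le_sum (f := fun i : Fin n => ‖g (X i ω) θ‖ ^ 3)
        (fun j _ => by positivity) (Finset.mem_univ i)).trans hthird.le
    have h7 : ‖w n‖ * ‖g (X i ω) θ‖ ≤ c / 8 := by
      refine (lt_of_pow_lt_pow_left₀ 3 (by positivity) (lt_of_le_of_lt ?_ hTK)).le
      rw [mul_pow]
      have := mul_le_mul_of_nonneg_left h6 (by positivity : (0 : ℝ) ≤ ‖w n‖ ^ 3)
      linarith
    rw [mul_add]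
    linarith
  refine (W_le_mul_norm_sq hn (half_pos hc) hbar hcov hsmall).trans (EReal.coe_le_coe_iff.2 ?_)
  have hs2 : √(n : ℝ) ^ 2 = n := Real.sq_sqrt hn'.le
  have h8 : √(n : ℝ) * ‖w n‖ ^ 2 ≤ ε * c / 4 := by
    refine (lt_of_pow_lt_pow_left₀ 2 (by positivity) (lt_of_le_of_lt (le_of_eq ?_) hTw)).le
    rw [mul_pow, hs2]
    ring
  rw [div_le_iff₀ (half_pos hc)]
  have h9 := mul_le_mul_of_nonneg_left h8 (Real.sqrt_nonneg (n : ℝ))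
  rw [← mul_assoc, ← sq, hs2] at h9
  linarith

end

end EmpiricalLikelihood

/-! ### Strong consistency -/

open EmpiricalLikelihood in
/-- Strong global consistency of the maximum empirical likelihood estimator: for an iid sample
`X 0, X 1, …` with law `F`, almost surely every sequence of global minimizers `t n` of `Wₙ` (built
from the first `n` observations) converges to `θstar`. -/
theorem theorem1 {Ω S : Type*} [MeasurableSpace Ω] [MeasurableSpace S]
    (μ : Measure Ω) [IsProbabilityMeasure μ] (F : Measure S)
    (X : ℕ → Ω → S) (hlaw : ∀ i, HasLaw (X i) F μ) (hindep : iIndepFun X μ)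
    {q m : ℕ} (g : S → EuclideanSpace ℝ (Fin q) → EuclideanSpace ℝ (Fin m))
    (Θ : Set (EuclideanSpace ℝ (Fin q))) (θstar : EuclideanSpace ℝ (Fin q))
    (h1 : C1 F g Θ θstar) (h2 : C2 F g Θ) (h3 : C3 F g Θ) (h4 : IsClosed Θ) (h5 : C5 F g Θ) :
    ∀ᵐ ω ∂μ, ∀ t : ℕ → EuclideanSpace ℝ (Fin q),
      (∀ᶠ n in atTop, IsMELE g Θ (fun i : Fin n => X i ω) (t n)) →
        Tendsto t atTop (𝓝 θstar) := by
  have : IsProbabilityMeasure F := (hlaw 0).isProbabilityMeasure_iff.1 ‹_›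
  obtain ⟨hmem, hiff⟩ := h1
  obtain ⟨R, hR⟩ := h5.exists_isLargeOn hlaw hindep h2 h3 h4
  have hlarge : ∀ j : ℕ, IsLargeOn μ X g {θ ∈ Θ | 1 / ((j : ℝ) + 1) ≤ dist θ θstar} := fun j => by
    have hK : IsCompact (Metric.closedBall 0 R ∩ (Θ ∩ {θ | 1 / ((j : ℝ) + 1) ≤ dist θ θstar})) :=
      (isCompact_closedBall 0 R).inter_right
        (h4.inter (isClosed_le continuous_const (continuous_id.dist continuous_const)))
    have hcpt := isLargeOn_of_isCompact hlaw hindep h2 h3 h4 hK (fun θ hθ => hθ.2.1)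
      fun θ hθ h0 => by
        have hd : 1 / ((j : ℝ) + 1) ≤ dist θ θstar := hθ.2.2
        rw [(hiff θ hθ.2.1).1 h0, dist_self] at hd
        exact absurd hd (not_le.2 (by positivity))
    refine (hcpt.union hR).mono fun θ hθ => ?_
    rcases le_total ‖θ‖ R with h | h
    · exact Or.inl ⟨by simpa using h, hθ⟩
    · exact Or.inr ⟨hθ.1, h⟩
  filter_upwards [ae_all_iff.2 hlarge, ae_eventually_W_le hlaw hindep (h2 θstar hmem).1
    (h2 θstar hmem).2 ((hiff θstar hmem).2 rfl)] with ω hlow hup t ht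
  refine Metric.tendsto_nhds.2 fun ε hε => ?_
  obtain ⟨j, hj⟩ := exists_nat_one_div_lt hε
  obtain ⟨c, hc, hlow⟩ := hlow j
  filter_upwards [ht, hlow, hup (c / 2) (half_pos hc), eventually_gt_atTop 0]
    with n hmin hlow hup hn
  by_contra! hcon
  have hle := (hlow (t n) ⟨hmin.1, hj.le.trans hcon⟩).trans ((hmin.2 θstar hmem).trans hup)
  have hs : 0 < √(n : ℝ) := Real.sqrt_pos.2 (by exact_mod_cast hn)
  nlinarith [EReal.coe_le_coe_iff.1 hle, mul_pos hc hs]
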